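/- **Floating-point model.** Let $\mathsf u>0$ be the unit roundoff. Every single real operation $\circ\in\{+,-,\times,/\}$ on real numbers returns a value $(x\circ y)(1+\delta)$ with an arbitrary $|\delta|\le\mathsf u$, and a run of an algorithm is any execution in this model (without division by zero). Sums may be evaluated in any order, and matrices are added and multiplied in the conventional way. The inverse of a real matrix $M\in\mathbb R^{n\times n}$ is computed via LU decomposition without interchanges: compute factors $L_M$ (unit lower triangular) and $U_M$ (upper triangular) by Gaussian elimination, compute $T\approx U_M^{-1}$ by solving $tU_M=e_i^{\mathsf T}$ by substitution for every row $t$ of $T$, and solve $V L_M=T$ by substitution for $V\approx M^{-1}$. For a real matrix $M$, $|M|$ is the matrix of absolute values of the entries; for a complex matrix it is the matrix of moduli; $\le$ between matrices is entrywise. **Algorithm (Frobenius inversion).** Let $Z=A+iB\in\mathrm{GL}_n(\mathbb C)$ with $A,B\in\mathbb R^{n\times n}$. Write $Z\in\mathcal S_1$ if $A$ and $A+BA^{-1}B$ are invertible, and $Z\in\mathcal S_2$ if $B$ and $B+AB^{-1}A$ are invertible. Put $(X,Y)=(A,B)$ if $Z\in\mathcal S_1$ and $(X,Y)=(B,A)$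 if $Z\in\mathcal S_2$ (if $Z$ lies in both sets, either choice is allowed). Compute, in this order, $X^{-1}$, $X^{-1}Y$, $Y(X^{-1}Y)$, $X+YX^{-1}Y$, $J=(X+YX^{-1}Y)^{-1}$, $K=(X^{-1}Y)J$, each step from the previously computed values, and return $J-iK$ in the first case and $K-iJ$ in the second. **Theorem.** There is an absolute constant $C>0$ with the following property. Let $n\ge 0$, let $Z\in\mathcal S_1\cup\mathcal S_2$, and let $X,Y$ be as above. Assume that $X$ and $X+YX^{-1}Y$ have (exact) LU decompositions with unit lower triangular first factor. Put $J=(X+YX^{-1}Y)^{-1}$ (exact). Then there are $\mathsf u_0>0$ and $\kappa\ge 0$, depending only on $n$, $Z$ and the choice of $(X,Y)$, such that for all $0<\mathsf u\le\mathsf u_0$ and every run of the algorithm on $Z$ with unit roundoff $\mathsf u$, with output $W$, computed value $P$ of $X+YX^{-1}Y$, computed LU factors $L_X,U_X$ of $X$ and $L_P,U_P$ of $P$, $$|Z^{-1}-W|\le C\,n\,\mathsf u\,\Big(|X^{-1}||L_X||U_X||X^{-1}||Y||J|+(|X^{-1}Y|+I)\,|J|\,\big(|X|+|Y||X^{-1}||L_X||U_X||X^{-1}||Y|+|L_P||U_P|\big)\,|J|\Big)+\kappa\,\mathsf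 u^2E,$$ where $E$ is the all-ones matrix. That is, the bound is $O(n)\,\mathsf u\,(\cdots)+O(\mathsf u^2)$. -/

import Mathlib

namespace FrobeniusInversion

/-! ### Floating-point arithmetic: the standard model with unit roundoff `u` -/

/-- `z` is an admissible computed value of a single arithmetic operation whose exact result is `x`:
`z = x (1 + δ)` with `|δ| ≤ u`. -/
def Fl (u x z : ℝ) : Prop := ∃ δ : ℝ, |δ| ≤ u ∧ z = x * (1 + δ)

/-- `z` is a computed value of the quotient `x / y`; there is none when `y = 0` (breakdown). -/
def FlDiv (u x y z : ℝ) : Prop := y ≠ 0 ∧ Fl u (x / y) z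

/-- `FlSum u s z`: `z` is a computed value of the sum of the (nonempty) multiset `s` of numbers,
added up by rounded binary additions in an arbitrary order and with arbitrary parentheses. -/
inductive FlSum (u : ℝ) : Multiset ℝ → ℝ → Prop
  | single (a : ℝ) : FlSum u {a} a
  | add {s t : Multiset ℝ} {x y z : ℝ} :
      FlSum u s x → FlSum u t y → Fl u (x + y) z → FlSum u (s + t) z

/-- `z` is a computed value of `∑ k ∈ s, a k * b k`. -/
def FlDot {n : ℕ} (u : ℝ) (s : Finset (Fin n)) (a b : Fin n → ℝ) (z : ℝ) : Prop :=
  ∃ p : Fin n → ℝ, (∀ k ∈ s, Fl u (a k * b k) (p k)) ∧ FlSum u (s.val.map p) z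

/-- `z` is a computed value of `c - ∑ k ∈ s, a k * b k`. -/
def FlSubDot {n : ℕ} (u c : ℝ) (s : Finset (Fin n)) (a b : Fin n → ℝ) (z : ℝ) : Prop :=
  ∃ p : Fin n → ℝ, (∀ k ∈ s, Fl u (a k * b k) (p k)) ∧
    FlSum u (c ::ₘ s.val.map (fun k => -p k)) z

/-! ### Real matrix operations in floating-point arithmetic -/

/-- `S` is a computed value of the sum `A + B`. -/
def FlMatAdd {n : ℕ} (u : ℝ) (A B S : Matrix (Fin n) (Fin n) ℝ) : Prop :=
  ∀ i j, Fl u (A i j + B i j) (S i j)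

/-- `C` is a computed value of the product `A * B` (conventional matrix multiplication). -/
def FlMatMul {n : ℕ} (u : ℝ) (A B C : Matrix (Fin n) (Fin n) ℝ) : Prop :=
  ∀ i j, FlDot u Finset.univ (fun k => A i k) (fun k => B k j) (C i j)

/-- `L` is unit lower triangular. -/
def IsUnitLower {n : ℕ} (L : Matrix (Fin n) (Fin n) ℝ) : Prop :=
  (∀ i, L i i = 1) ∧ ∀ i j, i < j → L i j = 0

/-- `U` is upper triangular. -/
def IsUpper {n : ℕ} (U : Matrix (Fin n) (Fin n) ℝ) : Prop :=
  ∀ i j, j < i → U i j = 0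

/-- `A` has an (exact) LU decomposition. -/
def HasLU {n : ℕ} (A : Matrix (Fin n) (Fin n) ℝ) : Prop :=
  ∃ L U : Matrix (Fin n) (Fin n) ℝ, IsUnitLower L ∧ IsUpper U ∧ A = L * U

/-- `L` and `U` are the computed factors of the LU decomposition of `A` (Gaussian elimination
without interchanges; the sums may be formed in any order, so that all the loop orderings of the
elimination are covered). -/
structure FlLU {n : ℕ} (u : ℝ) (A L U : Matrix (Fin n) (Fin n) ℝ) : Prop where
  lower : IsUnitLower L
  upper : IsUpper U
  upper_entry : ∀ k j, k ≤ j →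
    FlSubDot u (A k j) (Finset.Iio k) (fun m => L k m) (fun m => U m j) (U k j)
  lower_entry : ∀ i k, k < i → ∃ s : ℝ,
    FlSubDot u (A i k) (Finset.Iio k) (fun m => L i m) (fun m => U m k) s ∧
      FlDiv u s (U k k) (L i k)

/-- `T` is the computed inverse of the upper triangular matrix `U`: every row `t` of `T` is obtained
from `t U = eᵢ` by forward substitution. -/
structure FlUpperInv {n : ℕ} (u : ℝ) (U T : Matrix (Fin n) (Fin n) ℝ) : Prop where
  upper : IsUpper T
  entry : ∀ i j, i ≤ j → ∃ s : ℝ,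
    FlSubDot u ((1 : Matrix (Fin n) (Fin n) ℝ) i j) (Finset.Ico i j)
      (fun k => T i k) (fun k => U k j) s ∧ FlDiv u s (U j j) (T i j)

/-- `V` is the solution of `V L = T`, with `L` unit lower triangular, computed by substitution. -/
def FlSolveLower {n : ℕ} (u : ℝ) (L T V : Matrix (Fin n) (Fin n) ℝ) : Prop :=
  ∀ i j, FlSubDot u (T i j) (Finset.Ioi j) (fun k => V i k) (fun k => L k j) (V i j)

/-- `V` is the inverse of `A` computed via LU decomposition, and `L`, `U` are the computed LU
factors: factor `A = L U`, compute `T = U⁻¹`, solve `V L = T` for `V`. -/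
def FlInverse {n : ℕ} (u : ℝ) (A L U V : Matrix (Fin n) (Fin n) ℝ) : Prop :=
  FlLU u A L U ∧ ∃ T : Matrix (Fin n) (Fin n) ℝ, FlUpperInv u U T ∧ FlSolveLower u L T V

/-! ### Frobenius inversion over `ℂ` -/

/-- The real part of a complex matrix. -/
def rePart {n : ℕ} (Z : Matrix (Fin n) (Fin n) ℂ) : Matrix (Fin n) (Fin n) ℝ := Z.map Complex.re

/-- The imaginary part of a complex matrix. -/
def imPart {n : ℕ} (Z : Matrix (Fin n) (Fin n) ℂ) : Matrix (Fin n) (Fin n) ℝ := Z.map Complex.im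

/-- The invertible `Z = A + iB` with `A` and `A + B A⁻¹ B` invertible. -/
def S₁ (n : ℕ) : Set (Matrix (Fin n) (Fin n) ℂ) :=
  {Z | IsUnit Z ∧ IsUnit (rePart Z) ∧ IsUnit (rePart Z + imPart Z * (rePart Z)⁻¹ * imPart Z)}

/-- The invertible `Z = A + iB` with `B` and `B + A B⁻¹ A` invertible. -/
def S₂ (n : ℕ) : Set (Matrix (Fin n) (Fin n) ℂ) :=
  {Z | IsUnit Z ∧ IsUnit (imPart Z) ∧ IsUnit (imPart Z + rePart Z * (imPart Z)⁻¹ * rePart Z)}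

/-- The complex matrix `R + i M`. -/
noncomputable def complexOf {n : ℕ} (R M : Matrix (Fin n) (Fin n) ℝ) :
    Matrix (Fin n) (Fin n) ℂ :=
  R.map (fun x : ℝ => (x : ℂ)) + Complex.I • M.map (fun x : ℝ => (x : ℂ))

/-- The two branches of the algorithm. -/
inductive Branch
  | first
  | second

/-- The inputs for which a branch may be taken. -/
def Branch.domain (b : Branch) (n : ℕ) : Set (Matrix (Fin n) (Fin n) ℂ) :=
  match b with
  | .first => S₁ n
  | .second => S₂ n

/-- `X = A` in the first branch and `X = B` in the second. -/
def Branch.X (b : Branch) {n : ℕ} (Z : Matrix (Fin n) (Fin n) ℂ) : Matrix (Fin n) (Fin n) ℝ :=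
  match b with
  | .first => rePart Z
  | .second => imPart Z

/-- `Y = B` in the first branch and `Y = A` in the second. -/
def Branch.Y (b : Branch) {n : ℕ} (Z : Matrix (Fin n) (Fin n) ℂ) : Matrix (Fin n) (Fin n) ℝ :=
  match b with
  | .first => imPart Z
  | .second => rePart Z

/-- The returned matrix: `J - iK` in the first branch and `K - iJ` in the second. -/
noncomputable def Branch.output (b : Branch) {n : ℕ} (J K : Matrix (Fin n) (Fin n) ℝ) :
    Matrix (Fin n) (Fin n) ℂ :=
  match b with
  | .first => complexOf J (-K)
  | .second => complexOf K (-J)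

/-- A run of Frobenius inversion on the input `Z`, along the branch `b`, in floating-point arithmetic
with unit roundoff `u`, that returns `W`. Here `LX`, `UX` and `LP`, `UP` are the LU factors computed
during the two real inversions and `P` is the computed value of `X + Y X⁻¹ Y`. -/
def FlFrobenius {n : ℕ} (u : ℝ) (b : Branch) (Z : Matrix (Fin n) (Fin n) ℂ)
    (LX UX P LP UP : Matrix (Fin n) (Fin n) ℝ) (W : Matrix (Fin n) (Fin n) ℂ) : Prop :=
  ∃ V H₁ H₂ J K : Matrix (Fin n) (Fin n) ℝ,
    FlInverse u (b.X Z) LX UX V ∧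
    FlMatMul u V (b.Y Z) H₁ ∧
    FlMatMul u (b.Y Z) H₁ H₂ ∧
    FlMatAdd u (b.X Z) H₂ P ∧
    FlInverse u P LP UP J ∧
    FlMatMul u H₁ J K ∧
    W = b.output J K

/-! ### The bound -/

/-- The entrywise absolute value of a real matrix. -/
def absM {n : ℕ} (A : Matrix (Fin n) (Fin n) ℝ) : Matrix (Fin n) (Fin n) ℝ := A.map (fun x => |x|)

/-- The exact matrix `J = (X + Y X⁻¹ Y)⁻¹`. -/
noncomputable def exactJ {n : ℕ} (X Y : Matrix (Fin n) (Fin n) ℝ) : Matrix (Fin n) (Fin n) ℝ :=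
  (X + Y * X⁻¹ * Y)⁻¹

/-- `|X⁻¹||L_X||U_X||X⁻¹||Y||J|
  + (|X⁻¹Y| + I)|J|(|X| + |Y||X⁻¹||L_X||U_X||X⁻¹||Y| + |L_P||U_P|)|J|`. -/
noncomputable def errorBound {n : ℕ} (X Y LX UX LP UP : Matrix (Fin n) (Fin n) ℝ) :
    Matrix (Fin n) (Fin n) ℝ :=
  absM X⁻¹ * absM LX * absM UX * absM X⁻¹ * absM Y * absM (exactJ X Y) +
    (absM (X⁻¹ * Y) + 1) * absM (exactJ X Y) *
      (absM X + absM Y * absM X⁻¹ * absM LX * absM UX * absM X⁻¹ * absM Y + absM LP * absM UP) *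
      absM (exactJ X Y)

end FrobeniusInversion

open Filter Topology Asymptotics

namespace FrobeniusInversion

/-! ### Rounding errors of sums and inner products -/

/-! Each elementary stage (LU factorisation, the two triangular solves, a product, a sum) has a
residual bounded entrywise by `18 n u` times the product or sum of the absolute values of the
matrices involved. Since the residuals involve computed factors, such as `|L||U|`, no growth
estimate is needed for the first-order term.

For an inversion the residuals combine exactly: `V S - 1` is the residual of `T U = 1`, plus that of
`V L = T` times `U`, minus `V` times that of `A = L U`, minus `V (A - S)`. As `|T| ≤ |V||L| + O(u)`
and `V = S⁻¹ + O(u)`, this gives `|V - S⁻¹| ≤ |S⁻¹| (3·18nu |L||U| + |A - S|) |S⁻¹| + O(u²)`, which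
is `FlInverse.error`. It allows a perturbed input `A`, because the second inversion is applied to
the rounded `P`.

In `frobenius_error` this is propagated through the algorithm. The point is that `|X⁻¹| ≤
|X⁻¹||L_X||U_X||X⁻¹| + O(u)`, because `X⁻¹ = X⁻¹ X X⁻¹` and `L_X U_X = X + O(u)`. Hence each later
rounding error has the same shape as the inversion error and only raises its integer constant, which
ends at 6; so `C = 6·18 = 108`. The factor `|X⁻¹Y| + I` collects the error of `J` once through `K`
and once directly.

The `O(u²)` terms need computed quantities that stay bounded as `u → 0`. Nonsingularity makes the
exact pivots nonzero, so the computed factors converge to the exact ones (`tendsto_of_flLU`) and the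
substitutions stay bounded. Runs are nondeterministic, so asymptotics are taken along a filter on
the type of all runs; the resulting constants are then uniform over runs. -/

theorem FlSum.card_pos {u : ℝ} {s : Multiset ℝ} {z : ℝ} (h : FlSum u s z) : 1 ≤ s.card := by
  induction h with
  | single a => simp
  | add _ _ _ ih₁ ih₂ => rw [Multiset.card_add]; omega

/-- Induction on the summation tree. With `a + 1` and `b + 1` terms in the two subtrees, the final
rounding multiplies each error factor by at most `1 + u`, and both `a + 1` and `b + 1` are at most
the new exponent `a + b + 1`. Hence the order of summation does not matter. -/
theorem FlSum.abs_sub_sum_le {u : ℝ} (hu : 0 ≤ u) {s : Multiset ℝ} {z : ℝ} (h : FlSum u s z) :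
    |z - s.sum| ≤ ((1 + u) ^ (s.card - 1) - 1) * (s.map fun x => |x|).sum := by
  induction h with
  | single a => simp
  | @add s t x y z hs ht hz ih₁ ih₂ =>
    obtain ⟨δ, hδ, rfl⟩ := hz
    obtain ⟨a, ha⟩ : ∃ a, s.card = a + 1 := ⟨_, (Nat.sub_add_cancel hs.card_pos).symm⟩
    obtain ⟨b, hb⟩ : ∃ b, t.card = b + 1 := ⟨_, (Nat.sub_add_cancel ht.card_pos).symm⟩
    rw [Multiset.card_add, Multiset.sum_add, Multiset.map_add, Multiset.sum_add]
    rw [ha] at ih₁ ⊢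
    rw [hb] at ih₂ ⊢
    have e : a + 1 + (b + 1) - 1 = a + b + 1 := by omega
    rw [e]
    simp only [Nat.add_sub_cancel] at ih₁ ih₂
    have hS := Multiset.abs_sum_le_sum_abs (s := s)
    have hT := Multiset.abs_sum_le_sum_abs (s := t)
    set S := s.sum
    set T := t.sum
    set S' := (s.map fun x => |x|).sum
    set T' := (t.map fun x => |x|).sum
    have hx : |x| ≤ (1 + u) ^ a * S' := by
      have := abs_sub_abs_le_abs_sub x S
      linarith
    have hy : |y| ≤ (1 + u) ^ b * T' := by
      have := abs_sub_abs_le_abs_sub y T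
      linarith
    have hxy : |(x + y) * δ| ≤ (|x| + |y|) * u := by
      rw [abs_mul]
      exact mul_le_mul (abs_add_le _ _) hδ (abs_nonneg _) (by positivity)
    have h1 : |(x + y) * (1 + δ) - (S + T)| ≤ |(x + y) * δ| + |x - S| + |y - T| := by
      have : (x + y) * (1 + δ) - (S + T) = (x + y) * δ + (x - S) + (y - T) := by ring
      rw [this]
      exact (abs_add_le _ _).trans (add_le_add_left (abs_add_le _ _) _)
    have hS0 : 0 ≤ S' := (abs_nonneg _).trans hS
    have hT0 : 0 ≤ T' := (abs_nonneg _).trans hT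
    have h1u : 1 ≤ 1 + u := by linarith
    have hp1 : (1 + u) ^ (a + 1) * S' ≤ (1 + u) ^ (a + b + 1) * S' :=
      mul_le_mul_of_nonneg_right (pow_le_pow_right₀ h1u (by omega)) hS0
    have hp2 : (1 + u) ^ (b + 1) * T' ≤ (1 + u) ^ (a + b + 1) * T' :=
      mul_le_mul_of_nonneg_right (pow_le_pow_right₀ h1u (by omega)) hT0
    have hux := mul_le_mul_of_nonneg_right hx hu
    have huy := mul_le_mul_of_nonneg_right hy hu
    rw [pow_succ] at hp1 hp2
    nlinarith

theorem Fl.abs_sub_le {u x z : ℝ} (h : Fl u x z) : |z - x| ≤ u * |x| := by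
  obtain ⟨δ, hδ, rfl⟩ := h
  have : x * (1 + δ) - x = δ * x := by ring
  rw [this, abs_mul]
  exact mul_le_mul_of_nonneg_right hδ (abs_nonneg _)

theorem Fl.abs_le {u x z : ℝ} (h : Fl u x z) : |z| ≤ (1 + u) * |x| := by
  have := h.abs_sub_le
  have := abs_sub_abs_le_abs_sub z x
  linarith

theorem FlDot.abs_sub_le {n : ℕ} {u : ℝ} (hu : 0 ≤ u) {s : Finset (Fin n)} {a b : Fin n → ℝ} {z : ℝ}
    (h : FlDot u s a b z) :
    |z - ∑ k ∈ s, a k * b k| ≤ ((1 + u) ^ s.card - 1) * ∑ k ∈ s, |a k| * |b k| := by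
  obtain ⟨p, hp, hz⟩ := h
  have h1 := hz.abs_sub_sum_le hu
  have hc := hz.card_pos
  rw [Multiset.card_map, Finset.card_val] at h1 hc
  rw [Multiset.map_map] at h1
  change |z - ∑ k ∈ s, p k| ≤ _ * ∑ k ∈ s, |p k| at h1
  obtain ⟨m, hm⟩ : ∃ m, s.card = m + 1 := ⟨_, (Nat.sub_add_cancel hc).symm⟩
  rw [hm] at h1 ⊢
  rw [Nat.add_sub_cancel] at h1
  have h2 : |∑ k ∈ s, p k - ∑ k ∈ s, a k * b k| ≤ u * ∑ k ∈ s, |a k| * |b k| := by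
    rw [← Finset.sum_sub_distrib, Finset.mul_sum]
    refine (Finset.abs_sum_le_sum_abs _ _).trans (Finset.sum_le_sum fun k hk => ?_)
    rw [← abs_mul]
    exact (hp k hk).abs_sub_le
  have h3 : ∑ k ∈ s, |p k| ≤ (1 + u) * ∑ k ∈ s, |a k| * |b k| := by
    rw [Finset.mul_sum]
    refine Finset.sum_le_sum fun k hk => ?_
    rw [← abs_mul]
    exact (hp k hk).abs_le
  have h4 : 0 ≤ (1 + u) ^ m - 1 := sub_nonneg.2 (one_le_pow₀ (by linarith))
  have h5 := mul_le_mul_of_nonneg_left h3 h4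
  have h6 := _root_.abs_sub_le z (∑ k ∈ s, p k) (∑ k ∈ s, a k * b k)
  rw [pow_succ]
  linarith

/-- There are `s.card + 1` summands, hence the exponent `s.card` from the additions; rounding the
products contributes one more factor `1 + u`. -/
theorem FlSubDot.abs_sub_le {n : ℕ} {u c : ℝ} (hu : 0 ≤ u) {s : Finset (Fin n)} {a b : Fin n → ℝ}
    {z : ℝ} (h : FlSubDot u c s a b z) :
    |z - (c - ∑ k ∈ s, a k * b k)| ≤
      ((1 + u) ^ (s.card + 1) - 1) * (|c| + ∑ k ∈ s, |a k| * |b k|) := by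
  obtain ⟨p, hp, hz⟩ := h
  have h1 := hz.abs_sub_sum_le hu
  rw [Multiset.card_cons, Multiset.card_map, Finset.card_val, Multiset.map_cons, Multiset.sum_cons,
    Multiset.sum_cons, Multiset.map_map, Nat.add_sub_cancel] at h1
  change |z - (c + ∑ k ∈ s, -p k)| ≤ _ * (|c| + ∑ k ∈ s, |-p k|) at h1
  simp only [abs_neg, Finset.sum_neg_distrib] at h1
  have h2 : |∑ k ∈ s, p k - ∑ k ∈ s, a k * b k| ≤ u * ∑ k ∈ s, |a k| * |b k| := by
    rw [← Finset.sum_sub_distrib, Finset.mul_sum]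
    refine (Finset.abs_sum_le_sum_abs _ _).trans (Finset.sum_le_sum fun k hk => ?_)
    rw [← abs_mul]
    exact (hp k hk).abs_sub_le
  have h3 : ∑ k ∈ s, |p k| ≤ (1 + u) * ∑ k ∈ s, |a k| * |b k| := by
    rw [Finset.mul_sum]
    refine Finset.sum_le_sum fun k hk => ?_
    rw [← abs_mul]
    exact (hp k hk).abs_le
  have h4 : 0 ≤ (1 + u) ^ s.card - 1 := sub_nonneg.2 (one_le_pow₀ (by linarith))
  have h5 := mul_le_mul_of_nonneg_left h3 h4
  have h6 := _root_.abs_sub_le z (c + -∑ k ∈ s, p k) (c - ∑ k ∈ s, a k * b k)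
  have h7 : |c + -∑ k ∈ s, p k - (c - ∑ k ∈ s, a k * b k)|
      = |∑ k ∈ s, p k - ∑ k ∈ s, a k * b k| := by
    rw [← abs_neg]; congr 1; ring
  have h8 : 0 ≤ (1 + u) ^ s.card * u * |c| := by positivity
  rw [pow_succ]
  nlinarith

/-- Compare `(1 + u) ^ n` with `exp (n u)` and use `|exp x - 1| ≤ 2 |x|` for `|x| ≤ 1`. -/
theorem one_add_pow_sub_one_le {n m : ℕ} (hm : m ≤ n) {u : ℝ} (hu : 0 ≤ u) (hnu : n * u ≤ 1) :
    (1 + u) ^ m - 1 ≤ 2 * n * u := by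
  have h1 : (1 + u) ^ m ≤ (1 + u) ^ n := pow_le_pow_right₀ (by linarith) hm
  have h2 : (1 + u) ^ n ≤ Real.exp (n * u) := by
    rw [Real.exp_nat_mul]
    exact pow_le_pow_left₀ (by linarith) (by linarith [Real.add_one_le_exp u]) _
  have h0 : 0 ≤ n * u := by positivity
  have h3 := Real.abs_exp_sub_one_le (x := n * u) (by rwa [abs_of_nonneg h0])
  rw [abs_of_nonneg h0] at h3
  linarith [le_abs_self (Real.exp (n * u) - 1)]

/-- Backward form: the datum `|c|` is traded for the computed `|z|`, so that later residuals involve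
only the computed factors. Since `|c| ≤ |e| + |S| + |z|` and `2nu ≤ 1/2`, the error `|e|` on the
right is absorbed into the left side. -/
theorem FlSubDot.abs_sub_le_of_small {n : ℕ} {u c : ℝ} (hu : 0 ≤ u) (hnu : 4 * (n * u) ≤ 1)
    {s : Finset (Fin n)} (hs : s.card < n) {a b : Fin n → ℝ} {z : ℝ} (h : FlSubDot u c s a b z) :
    |c - ∑ k ∈ s, a k * b k - z| ≤ 8 * (n * u) * (|z| + ∑ k ∈ s, |a k| * |b k|) := by
  have h1 := h.abs_sub_le hu
  have h0 : 0 ≤ n * u := by positivity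
  have h2 := one_add_pow_sub_one_le (m := s.card + 1) hs hu (by linarith)
  have hS : |∑ k ∈ s, a k * b k| ≤ ∑ k ∈ s, |a k| * |b k| := by
    simpa only [abs_mul] using Finset.abs_sum_le_sum_abs (fun k => a k * b k) s
  rw [abs_sub_comm] at h1
  set S := ∑ k ∈ s, a k * b k
  set S' := ∑ k ∈ s, |a k| * |b k|
  have hS0 : 0 ≤ S' := (abs_nonneg _).trans hS
  set e := c - S - z with he
  have hc : |c| ≤ |e| + |S| + |z| := by
    have : c = e + S + z := by rw [he]; ring
    calc |c| = |e + S + z| := by rw [← this]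
      _ ≤ _ := (abs_add_le _ _).trans (add_le_add_left (abs_add_le _ _) _)
  have h3 : |e| ≤ 2 * (n * u) * (|c| + S') :=
    h1.trans (mul_le_mul_of_nonneg_right (by linarith) (by positivity))
  have h4 : |e| ≤ 2 * (n * u) * (|e| + |z| + 2 * S') :=
    h3.trans (mul_le_mul_of_nonneg_left (by linarith) (by positivity))
  have h5 : 2 * (n * u) * |e| ≤ 1 / 2 * |e| :=
    mul_le_mul_of_nonneg_right (by linarith) (abs_nonneg _)
  have h6 : 0 ≤ (n * u) * |z| := by positivity
  linarith

/-- As `1 + δ ≥ 1/2`, the numerator satisfies `|x| ≤ 2 |z y|`, which turns the relative error into a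
residual bound. -/
theorem FlDiv.abs_sub_le {u x y z : ℝ} (h : FlDiv u x y z) (hu' : u ≤ 1 / 2) :
    |x - z * y| ≤ 2 * u * (|z| * |y|) := by
  obtain ⟨hy, δ, hδ, rfl⟩ := h
  have h1 : x / y * (1 + δ) * y = x * (1 + δ) := by field_simp
  rw [← abs_mul, h1, abs_mul]
  have h2 : x - x * (1 + δ) = -(x * δ) := by ring
  rw [h2, abs_neg, abs_mul]
  have h3 : 1 / 2 ≤ |1 + δ| := (by linarith [neg_abs_le δ] : 1 / 2 ≤ 1 + δ).trans (le_abs_self _)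
  have h0 : 0 ≤ u := (abs_nonneg _).trans hδ
  have h4 : |x| * |δ| ≤ |x| * u := mul_le_mul_of_nonneg_left hδ (abs_nonneg _)
  have h5 : |x| * u * (1 / 2) ≤ |x| * u * |1 + δ| :=
    mul_le_mul_of_nonneg_left h3 (by positivity)
  linarith

theorem abs_sub_le_of_flSubDot_of_flDiv {n : ℕ} {u c : ℝ} (hu : 0 ≤ u) (hnu : 4 * (n * u) ≤ 1)
    {s : Finset (Fin n)} (hs : s.card < n) {a b : Fin n → ℝ} {t y z : ℝ}
    (h : FlSubDot u c s a b t) (h' : FlDiv u t y z) :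
    |c - ∑ k ∈ s, a k * b k - z * y| ≤
      18 * (n * u) * (|z| * |y| + ∑ k ∈ s, |a k| * |b k|) := by
  have hn : (1 : ℝ) ≤ n := by exact_mod_cast (by omega : 1 ≤ n)
  have hun : u ≤ n * u := le_mul_of_one_le_left hu hn
  have h1 := h.abs_sub_le_of_small hu hnu hs
  have h2 := h'.abs_sub_le (by linarith)
  have hS0 : 0 ≤ ∑ k ∈ s, |a k| * |b k| := Finset.sum_nonneg fun _ _ => by positivity
  set S := ∑ k ∈ s, a k * b k
  set S' := ∑ k ∈ s, |a k| * |b k|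
  have h3 : |t| ≤ |t - z * y| + |z| * |y| := by
    rw [← abs_mul]; linarith [abs_sub_abs_le_abs_sub t (z * y)]
  have hzy : 0 ≤ |z| * |y| := by positivity
  have h4 : 2 * u * (|z| * |y|) ≤ 2 * (n * u) * (|z| * |y|) :=
    mul_le_mul_of_nonneg_right (by linarith) hzy
  have h5 : 2 * u * (|z| * |y|) ≤ 1 * (|z| * |y|) :=
    mul_le_mul_of_nonneg_right (by linarith) hzy
  -- With `|t| ≤ 2 |z||y|` the subtraction contributes `16nu |z||y|` and the division `2nu |z||y|`;
  -- this is the origin of the constant 18 used for all operations.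
  have h6 : 8 * (n * u) * (|t| + S') ≤ 8 * (n * u) * (2 * (|z| * |y|) + S') :=
    mul_le_mul_of_nonneg_left (by linarith) (by positivity)
  have h7 := _root_.abs_sub_le (c - S) t (z * y)
  have h8 : 0 ≤ n * u * S' := by positivity
  linarith

/-! ### Componentwise backward error bounds -/

theorem FlMatMul.abs_sub_le {n : ℕ} {u : ℝ} (hu : 0 ≤ u) (hnu : 4 * (n * u) ≤ 1)
    {A B C : Matrix (Fin n) (Fin n) ℝ} (h : FlMatMul u A B C) (i j : Fin n) :
    absM (C - A * B) i j ≤ 18 * (n * u) * (absM A * absM B) i j := by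
  have h1 := (h i j).abs_sub_le hu
  have h0 : 0 ≤ n * u := by positivity
  have h2 := one_add_pow_sub_one_le (n := n) le_rfl hu (by linarith)
  rw [Finset.card_univ, Fintype.card_fin] at h1
  simp only [absM, Matrix.map_apply, Matrix.sub_apply, Matrix.mul_apply]
  exact h1.trans (mul_le_mul_of_nonneg_right (by linarith)
    (Finset.sum_nonneg fun _ _ => by positivity))

theorem FlMatAdd.abs_sub_le {n : ℕ} {u : ℝ} (hu : 0 ≤ u)
    {A B S : Matrix (Fin n) (Fin n) ℝ} (h : FlMatAdd u A B S) (i j : Fin n) :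
    absM (S - (A + B)) i j ≤ 18 * (n * u) * (absM A + absM B) i j := by
  -- The index `i` forces `n ≥ 1`, so a single rounding error `u` fits under the common unit `18 n
  -- u`.
  have hn : (1 : ℝ) ≤ n := by exact_mod_cast (by have := i.2; omega : 1 ≤ n)
  have hun : u ≤ n * u := le_mul_of_one_le_left hu hn
  simp only [absM, Matrix.map_apply, Matrix.sub_apply, Matrix.add_apply]
  exact (h i j).abs_sub_le.trans
    (mul_le_mul (by linarith) (abs_add_le _ _) (abs_nonneg _) (by positivity))

/-- A sum whose terms vanish outside `insert a s`. -/
theorem sum_univ_eq_add_sum {n : ℕ} {f : Fin n → ℝ} {a : Fin n} {s : Finset (Fin n)} (ha : a ∉ s)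
    (hf : ∀ k, k ≠ a → k ∉ s → f k = 0) : ∑ k, f k = f a + ∑ k ∈ s, f k := by
  rw [← Finset.sum_insert ha]
  symm
  apply Finset.sum_subset (Finset.subset_univ _)
  intro k _ hk
  rw [Finset.mem_insert, not_or] at hk
  exact hf k hk.1 hk.2

theorem card_lt_of_not_mem {n : ℕ} {a : Fin n} {s : Finset (Fin n)} (ha : a ∉ s) : s.card < n := by
  simpa using Finset.card_lt_univ_of_notMem ha

theorem IsUnitLower.mul_apply_of_le {n : ℕ} {L U : Matrix (Fin n) (Fin n) ℝ} (hL : IsUnitLower L)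
    (k j : Fin n) : (L * U) k j = U k j + ∑ m ∈ Finset.Iio k, L k m * U m j := by
  rw [Matrix.mul_apply, sum_univ_eq_add_sum (a := k) (s := Finset.Iio k) (by simp), hL.1, one_mul]
  intro m hm hm'
  rw [hL.2 k m (lt_of_le_of_ne (by simpa using hm') hm.symm), zero_mul]

theorem IsUpper.mul_apply_of_lt {n : ℕ} {L U : Matrix (Fin n) (Fin n) ℝ} (hU : IsUpper U)
    (i k : Fin n) : (L * U) i k = L i k * U k k + ∑ m ∈ Finset.Iio k, L i m * U m k := by
  rw [Matrix.mul_apply, sum_univ_eq_add_sum (a := k) (s := Finset.Iio k) (by simp)]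
  intro m hm hm'
  rw [hU m k (lt_of_le_of_ne (by simpa using hm') hm.symm), mul_zero]

theorem IsUpper.mul_apply_upper {n : ℕ} {T U : Matrix (Fin n) (Fin n) ℝ} (hT : IsUpper T)
    (hU : IsUpper U) (i j : Fin n) :
    (T * U) i j = T i j * U j j + ∑ k ∈ Finset.Ico i j, T i k * U k j := by
  rw [Matrix.mul_apply, sum_univ_eq_add_sum (a := j) (s := Finset.Ico i j) (by simp)]
  intro k hk hk'
  rw [Finset.mem_Ico, not_and_or, not_le, not_lt] at hk'
  rcases hk' with h | h
  · rw [hT i k h, zero_mul]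
  · rw [hU k j (lt_of_le_of_ne h hk.symm), mul_zero]

theorem IsUnitLower.mul_apply_right {n : ℕ} {V L : Matrix (Fin n) (Fin n) ℝ} (hL : IsUnitLower L)
    (i j : Fin n) : (V * L) i j = V i j + ∑ k ∈ Finset.Ioi j, V i k * L k j := by
  rw [Matrix.mul_apply, sum_univ_eq_add_sum (a := j) (s := Finset.Ioi j) (by simp), hL.1, mul_one]
  intro k hk hk'
  rw [hL.2 k j (lt_of_le_of_ne (by simpa using hk') hk), mul_zero]

theorem IsUnitLower.absM {n : ℕ} {L : Matrix (Fin n) (Fin n) ℝ} (hL : IsUnitLower L) :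
    IsUnitLower (absM L) :=
  ⟨fun i => by simp [FrobeniusInversion.absM, hL.1],
    fun i j h => by simp [FrobeniusInversion.absM, hL.2 i j h]⟩

theorem IsUpper.absM {n : ℕ} {U : Matrix (Fin n) (Fin n) ℝ} (hU : IsUpper U) :
    IsUpper (absM U) :=
  fun i j h => by simp [FrobeniusInversion.absM, hU i j h]

theorem FlLU.abs_sub_le {n : ℕ} {u : ℝ} (hu : 0 ≤ u) (hnu : 4 * (n * u) ≤ 1)
    {A L U : Matrix (Fin n) (Fin n) ℝ} (h : FlLU u A L U) (i j : Fin n) :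
    absM (L * U - A) i j ≤ 18 * (n * u) * (absM L * absM U) i j := by
  rcases le_or_gt i j with hij | hij
  · have h1 := (h.upper_entry i j hij).abs_sub_le_of_small hu hnu
      (card_lt_of_not_mem (a := i) (by simp))
    rw [h.lower.absM.mul_apply_of_le]
    simp only [absM, Matrix.map_apply, Matrix.sub_apply]
    rw [h.lower.mul_apply_of_le, abs_sub_comm, add_comm, ← sub_sub]
    have hS : 0 ≤ ∑ m ∈ Finset.Iio i, |L i m| * |U m j| :=
      Finset.sum_nonneg fun _ _ => by positivity
    exact h1.trans (mul_le_mul_of_nonneg_right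
      (by linarith [(by positivity : 0 ≤ n * u)]) (by positivity))
  · obtain ⟨s, hs, hd⟩ := h.lower_entry i j hij
    have h1 := abs_sub_le_of_flSubDot_of_flDiv hu hnu (card_lt_of_not_mem (a := j) (by simp)) hs hd
    rw [h.upper.absM.mul_apply_of_lt]
    simp only [absM, Matrix.map_apply, Matrix.sub_apply]
    rwa [h.upper.mul_apply_of_lt, abs_sub_comm, add_comm (L i j * U j j), ← sub_sub]

theorem FlUpperInv.abs_sub_le {n : ℕ} {u : ℝ} (hu : 0 ≤ u) (hnu : 4 * (n * u) ≤ 1)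
    {U T : Matrix (Fin n) (Fin n) ℝ} (hU : IsUpper U) (h : FlUpperInv u U T) (i j : Fin n) :
    absM (T * U - 1) i j ≤ 18 * (n * u) * (absM T * absM U) i j := by
  rcases le_or_gt i j with hij | hij
  · obtain ⟨s, hs, hd⟩ := h.entry i j hij
    have h1 := abs_sub_le_of_flSubDot_of_flDiv hu hnu (card_lt_of_not_mem (a := j) (by simp)) hs hd
    rw [h.upper.absM.mul_apply_upper hU.absM]
    simp only [absM, Matrix.map_apply, Matrix.sub_apply]
    rwa [h.upper.mul_apply_upper hU, abs_sub_comm, add_comm (T i j * U j j), ← sub_sub]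
  · have h0 : 0 ≤ (absM T * absM U) i j := by
      rw [Matrix.mul_apply]
      exact Finset.sum_nonneg fun _ _ => mul_nonneg (abs_nonneg _) (abs_nonneg _)
    have h1 : (T * U) i j = 0 := by
      rw [h.upper.mul_apply_upper hU, h.upper i j hij, Finset.Ico_eq_empty (by simp [hij.le])]
      simp
    simp only [absM, Matrix.map_apply, Matrix.sub_apply, h1, Matrix.one_apply_ne hij.ne'] at h0 ⊢
    simp only [sub_zero, abs_zero]
    positivity

theorem FlSolveLower.abs_sub_le {n : ℕ} {u : ℝ} (hu : 0 ≤ u) (hnu : 4 * (n * u) ≤ 1)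
    {L T V : Matrix (Fin n) (Fin n) ℝ} (hL : IsUnitLower L) (h : FlSolveLower u L T V)
    (i j : Fin n) :
    absM (V * L - T) i j ≤ 18 * (n * u) * (absM V * absM L) i j := by
  have h1 := (h i j).abs_sub_le_of_small hu hnu (card_lt_of_not_mem (a := j) (by simp))
  rw [hL.absM.mul_apply_right]
  simp only [absM, Matrix.map_apply, Matrix.sub_apply]
  rw [hL.mul_apply_right, abs_sub_comm, add_comm (V i j), ← sub_sub]
  have hS : 0 ≤ ∑ k ∈ Finset.Ioi j, |V i k| * |L k j| :=
    Finset.sum_nonneg fun _ _ => by positivity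
  exact h1.trans (mul_le_mul_of_nonneg_right
    (by linarith [(by positivity : 0 ≤ n * u)]) (by positivity))

/-! ### Computed factors as the unit roundoff tends to zero -/

theorem FlSubDot.abs_sub_le_two_mul {n : ℕ} {u c : ℝ} (hu : 0 ≤ u) (hnu : 4 * (n * u) ≤ 1)
    {s : Finset (Fin n)} (hs : s.card < n) {a b : Fin n → ℝ} {z : ℝ} (h : FlSubDot u c s a b z) :
    |z - (c - ∑ k ∈ s, a k * b k)| ≤ 2 * n * u * (|c| + ∑ k ∈ s, |a k| * |b k|) := by
  have h0 : 0 ≤ n * u := by positivity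
  refine (h.abs_sub_le hu).trans (mul_le_mul_of_nonneg_right
    (one_add_pow_sub_one_le hs hu (by linarith)) ?_)
  exact add_nonneg (abs_nonneg _) (Finset.sum_nonneg fun _ _ => by positivity)

theorem FlSubDot.abs_le {n : ℕ} {u c : ℝ} (hu : 0 ≤ u) (hnu : 4 * (n * u) ≤ 1)
    {s : Finset (Fin n)} (hs : s.card < n) {a b : Fin n → ℝ} {z : ℝ} (h : FlSubDot u c s a b z) :
    |z| ≤ 2 * (|c| + ∑ k ∈ s, |a k| * |b k|) := by
  have h1 := h.abs_sub_le_two_mul hu hnu hs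
  have hS : |∑ k ∈ s, a k * b k| ≤ ∑ k ∈ s, |a k| * |b k| := by
    simpa only [abs_mul] using Finset.abs_sum_le_sum_abs (fun k => a k * b k) s
  have hS0 := (abs_nonneg _).trans hS
  have h2 := abs_sub_abs_le_abs_sub z (c - ∑ k ∈ s, a k * b k)
  have h3 := _root_.abs_sub c (∑ k ∈ s, a k * b k)
  have h4 : 2 * n * u * (|c| + ∑ k ∈ s, |a k| * |b k|) ≤ 1 * (|c| + ∑ k ∈ s, |a k| * |b k|) :=
    mul_le_mul_of_nonneg_right (by linarith) (by positivity)
  linarith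

section

variable {Ω : Type*} {l : Filter Ω} {u : Ω → ℝ} {n : ℕ}

theorem eventually_four_mul_le_one (n : ℕ) (hu : Tendsto u l (𝓝 0)) :
    ∀ᶠ ω in l, 4 * (n * u ω) ≤ 1 := by
  have h : Tendsto (fun ω => 4 * (n * u ω)) l (𝓝 (4 * (n * 0))) := (hu.const_mul _).const_mul _
  rw [mul_zero, mul_zero] at h
  exact h.eventually_le_const one_pos

theorem tendsto_of_flSubDot (hu0 : ∀ ω, 0 ≤ u ω) (hu : Tendsto u l (𝓝 0)) {c z : Ω → ℝ}
    {s : Finset (Fin n)} (hs : s.card < n) {a b : Ω → Fin n → ℝ} {c₀ : ℝ} {a₀ b₀ : Fin n → ℝ}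
    (hc : Tendsto c l (𝓝 c₀)) (ha : ∀ k ∈ s, Tendsto (fun ω => a ω k) l (𝓝 (a₀ k)))
    (hb : ∀ k ∈ s, Tendsto (fun ω => b ω k) l (𝓝 (b₀ k)))
    (h : ∀ ω, FlSubDot (u ω) (c ω) s (a ω) (b ω) (z ω)) :
    Tendsto z l (𝓝 (c₀ - ∑ k ∈ s, a₀ k * b₀ k)) := by
  have h1 : Tendsto (fun ω => c ω - ∑ k ∈ s, a ω k * b ω k) l (𝓝 (c₀ - ∑ k ∈ s, a₀ k * b₀ k)) :=
    hc.sub (tendsto_finsetSum _ fun k hk => (ha k hk).mul (hb k hk))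
  have h2 : Tendsto (fun ω => 2 * n * u ω * (|c ω| + ∑ k ∈ s, |a ω k| * |b ω k|)) l
      (𝓝 (2 * n * 0 * (|c₀| + ∑ k ∈ s, |a₀ k| * |b₀ k|))) :=
    (hu.const_mul _).mul (hc.abs.add
      (tendsto_finsetSum _ fun k hk => (ha k hk).abs.mul (hb k hk).abs))
  rw [mul_zero, zero_mul] at h2
  have h3 : Tendsto (fun ω => z ω - (c ω - ∑ k ∈ s, a ω k * b ω k)) l (𝓝 0) := by
    refine squeeze_zero_norm' ?_ h2
    filter_upwards [eventually_four_mul_le_one n hu] with ω hω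
    exact (h ω).abs_sub_le_two_mul (hu0 ω) hω hs
  simpa using h3.add h1

theorem tendsto_of_flDiv (hu : Tendsto u l (𝓝 0)) {x y z : Ω → ℝ} {x₀ y₀ : ℝ}
    (hx : Tendsto x l (𝓝 x₀)) (hy : Tendsto y l (𝓝 y₀)) (hy₀ : y₀ ≠ 0)
    (h : ∀ ω, FlDiv (u ω) (x ω) (y ω) (z ω)) : Tendsto z l (𝓝 (x₀ / y₀)) := by
  have h1 := hx.div hy hy₀
  have h2 : Tendsto (fun ω => u ω * |x ω / y ω|) l (𝓝 (0 * |x₀ / y₀|)) := hu.mul h1.abs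
  rw [zero_mul] at h2
  have h3 : Tendsto (fun ω => z ω - x ω / y ω) l (𝓝 0) :=
    squeeze_zero_norm (fun ω => (h ω).2.abs_sub_le) h2
  simpa using h3.add h1

theorem IsUpper.diag_ne_zero {L U : Matrix (Fin n) (Fin n) ℝ} (hU : IsUpper U)
    (h : IsUnit (L * U)) (k : Fin n) : U k k ≠ 0 := by
  have h1 : IsUnit U.det := by
    rw [Matrix.isUnit_iff_isUnit_det, Matrix.det_mul] at h
    exact isUnit_of_mul_isUnit_right h
  rw [Matrix.det_of_isUpperTriangular (fun i j hij => hU i j hij)] at h1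
  exact (Finset.prod_ne_zero_iff.1 h1.ne_zero) k (Finset.mem_univ k)

/-- Elimination is continuous wherever the pivots are nonzero, and the pivots of the limit are
nonzero because `L₀ * U₀` is invertible. Strong induction on `k` treats row `k` of `U` and column
`k` of `L` together, the row first because the column is divided by its pivot. -/
theorem tendsto_of_flLU (hu0 : ∀ ω, 0 ≤ u ω) (hu : Tendsto u l (𝓝 0))
    {A L U : Ω → Matrix (Fin n) (Fin n) ℝ} {L₀ U₀ : Matrix (Fin n) (Fin n) ℝ}
    (hL₀ : IsUnitLower L₀) (hU₀ : IsUpper U₀) (hLU : IsUnit (L₀ * U₀))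
    (hA : ∀ i j, Tendsto (fun ω => A ω i j) l (𝓝 ((L₀ * U₀) i j)))
    (h : ∀ ω, FlLU (u ω) (A ω) (L ω) (U ω)) (i j : Fin n) :
    Tendsto (fun ω => L ω i j) l (𝓝 (L₀ i j)) ∧ Tendsto (fun ω => U ω i j) l (𝓝 (U₀ i j)) := by
  have key : ∀ k : Fin n, (∀ i, Tendsto (fun ω => L ω i k) l (𝓝 (L₀ i k))) ∧
      ∀ j, Tendsto (fun ω => U ω k j) l (𝓝 (U₀ k j)) := by
    intro k
    induction k using WellFoundedLT.induction with
    | _ k ih =>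
      have hUk : ∀ j, Tendsto (fun ω => U ω k j) l (𝓝 (U₀ k j)) := by
        intro j
        rcases le_or_gt k j with hkj | hkj
        · have h1 := tendsto_of_flSubDot hu0 hu (card_lt_of_not_mem (a := k) (by simp)) (hA k j)
            (fun m hm => (ih m (by simpa using hm)).1 k)
            (fun m hm => (ih m (by simpa using hm)).2 j)
            (fun ω => (h ω).upper_entry k j hkj)
          rwa [hL₀.mul_apply_of_le, add_sub_cancel_right] at h1
        · simp only [fun ω => (h ω).upper k j hkj, hU₀ k j hkj]
          exact tendsto_const_nhds
      refine ⟨fun i => ?_, hUk⟩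
      rcases lt_trichotomy i k with hik | rfl | hik
      · simp only [fun ω => (h ω).lower.2 i k hik, hL₀.2 i k hik]
        exact tendsto_const_nhds
      · simp only [fun ω => (h ω).lower.1 i, hL₀.1 i]
        exact tendsto_const_nhds
      · choose s hs hd using fun ω => (h ω).lower_entry i k hik
        have hk := hU₀.diag_ne_zero hLU k
        have h1 := tendsto_of_flSubDot hu0 hu (card_lt_of_not_mem (a := k) (by simp)) (hA i k)
          (fun m hm => (ih m (by simpa using hm)).1 i)
          (fun m hm => (ih m (by simpa using hm)).2 k) hs
        rw [hU₀.mul_apply_of_lt, add_sub_cancel_right] at h1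
        have h2 := tendsto_of_flDiv hu h1 (hUk k) hk hd
        rwa [mul_div_cancel_right₀ _ hk] at h2
  exact ⟨(key j).1 i, (key i).2 j⟩

theorem isBigO_one_of_flSubDot (hu0 : ∀ ω, 0 ≤ u ω) (hu : Tendsto u l (𝓝 0)) {c z : Ω → ℝ}
    {s : Finset (Fin n)} (hs : s.card < n) {a b : Ω → Fin n → ℝ}
    (hc : c =O[l] fun _ => (1 : ℝ)) (ha : ∀ k ∈ s, (fun ω => a ω k) =O[l] fun _ => (1 : ℝ))
    (hb : ∀ k ∈ s, (fun ω => b ω k) =O[l] fun _ => (1 : ℝ))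
    (h : ∀ ω, FlSubDot (u ω) (c ω) s (a ω) (b ω) (z ω)) : z =O[l] fun _ => (1 : ℝ) := by
  have h1 : (fun ω => |c ω| + ∑ k ∈ s, |a ω k| * |b ω k|) =O[l] fun _ => (1 : ℝ) := by
    refine hc.abs_left.add (IsBigO.fun_sum fun k hk => ?_)
    simpa using (ha k hk).abs_left.mul (hb k hk).abs_left
  refine IsBigO.trans (IsBigO.of_bound 2 ?_) h1
  filter_upwards [eventually_four_mul_le_one n hu] with ω hω
  refine ((h ω).abs_le (hu0 ω) hω hs).trans ?_
  exact mul_le_mul_of_nonneg_left (le_abs_self _) two_pos.le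

theorem isBigO_one_of_flDiv (hu : Tendsto u l (𝓝 0)) {x y z : Ω → ℝ} {y₀ : ℝ}
    (hx : x =O[l] fun _ => (1 : ℝ)) (hy : Tendsto y l (𝓝 y₀)) (hy₀ : y₀ ≠ 0)
    (h : ∀ ω, FlDiv (u ω) (x ω) (y ω) (z ω)) : z =O[l] fun _ => (1 : ℝ) := by
  have h1 : (fun ω => x ω / y ω) =O[l] fun _ => (1 : ℝ) := by
    simpa [div_eq_mul_inv] using hx.mul ((hy.inv₀ hy₀).isBigO_one ℝ)
  refine IsBigO.trans (IsBigO.of_bound 2 ?_) h1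
  filter_upwards [hu.eventually_le_const one_pos] with ω hω
  exact (h ω).2.abs_le.trans (mul_le_mul_of_nonneg_right (by linarith) (abs_nonneg _))

/-- Boundedness is all that is needed of `T`: induction along the columns, the divisors having
nonzero limits. -/
theorem isBigO_one_of_flUpperInv (hu0 : ∀ ω, 0 ≤ u ω) (hu : Tendsto u l (𝓝 0))
    {U T : Ω → Matrix (Fin n) (Fin n) ℝ} {U₀ : Matrix (Fin n) (Fin n) ℝ}
    (hU₀ : ∀ k, U₀ k k ≠ 0) (hU : ∀ i j, Tendsto (fun ω => U ω i j) l (𝓝 (U₀ i j)))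
    (h : ∀ ω, FlUpperInv (u ω) (U ω) (T ω)) (i j : Fin n) :
    (fun ω => T ω i j) =O[l] fun _ => (1 : ℝ) := by
  induction j using WellFoundedLT.induction with
  | _ j ih =>
    rcases le_or_gt i j with hij | hij
    · choose s hs hd using fun ω => (h ω).entry i j hij
      refine isBigO_one_of_flDiv hu ?_ (hU j j) (hU₀ j) hd
      exact isBigO_one_of_flSubDot hu0 hu (card_lt_of_not_mem (a := j) (by simp))
        (isBigO_const_const _ one_ne_zero _)
        (fun k hk => ih k (Finset.mem_Ico.1 hk).2) (fun k _ => (hU k j).isBigO_one ℝ) hs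
    · simp only [fun ω => (h ω).upper i j hij]
      exact isBigO_const_const _ one_ne_zero _

theorem isBigO_one_of_flSolveLower (hu0 : ∀ ω, 0 ≤ u ω) (hu : Tendsto u l (𝓝 0))
    {L T V : Ω → Matrix (Fin n) (Fin n) ℝ} (hL : ∀ i j, (fun ω => L ω i j) =O[l] fun _ => (1 : ℝ))
    (hT : ∀ i j, (fun ω => T ω i j) =O[l] fun _ => (1 : ℝ))
    (h : ∀ ω, FlSolveLower (u ω) (L ω) (T ω) (V ω)) (i j : Fin n) :
    (fun ω => V ω i j) =O[l] fun _ => (1 : ℝ) := by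
  induction j using WellFoundedGT.induction with
  | _ j ih =>
    exact isBigO_one_of_flSubDot hu0 hu (card_lt_of_not_mem (a := j) (by simp)) (hT i j)
      (fun k hk => ih k (by simpa using hk)) (fun k _ => hL k j) (fun ω => h ω i j)

end

/-! ### Entrywise inequalities up to powers of the unit roundoff -/

section

variable {Ω : Type*} {n : ℕ}

/-- All entries of the matrices `F ω` are `O(u ^ p)`. -/
def MatO (l : Filter Ω) (u : Ω → ℝ) (p : ℕ) (F : Ω → Matrix (Fin n) (Fin n) ℝ) : Prop :=
  ∀ i j, (fun ω => F ω i j) =O[l] fun ω => u ω ^ p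

/-- The entrywise inequality `F ≤ G + O(u ^ p)`. -/
def MatLE (l : Filter Ω) (u : Ω → ℝ) (p : ℕ) (F G : Ω → Matrix (Fin n) (Fin n) ℝ) : Prop :=
  ∃ R, MatO l u p R ∧ ∀ᶠ ω in l, ∀ i j, F ω i j ≤ G ω i j + R ω i j

variable {l : Filter Ω} {u : Ω → ℝ} {p q : ℕ} {F G H M F' G' : Ω → Matrix (Fin n) (Fin n) ℝ}

theorem absM_nonneg (A : Matrix (Fin n) (Fin n) ℝ) (i j : Fin n) : 0 ≤ absM A i j := abs_nonneg _

theorem absM_add_le (A B : Matrix (Fin n) (Fin n) ℝ) (i j : Fin n) :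
    absM (A + B) i j ≤ (absM A + absM B) i j := abs_add_le _ _

theorem absM_neg (A : Matrix (Fin n) (Fin n) ℝ) : absM (-A) = absM A := by
  ext i j; simp [absM]

theorem absM_mul_le (A B : Matrix (Fin n) (Fin n) ℝ) (i j : Fin n) :
    absM (A * B) i j ≤ (absM A * absM B) i j := by
  simp only [absM, Matrix.map_apply, Matrix.mul_apply, ← abs_mul]
  exact Finset.abs_sum_le_sum_abs _ _

theorem matO_of_isBigO_one (h : ∀ i j, (fun ω => F ω i j) =O[l] fun _ => (1 : ℝ)) :
    MatO l u 0 F := by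
  simpa only [MatO, pow_zero] using h

theorem matO_const (A : Matrix (Fin n) (Fin n) ℝ) : MatO l u 0 fun _ => A :=
  matO_of_isBigO_one fun _ _ => isBigO_const_const _ one_ne_zero _

theorem MatO.isBigO_one (h : MatO l u 0 F) (i j : Fin n) :
    (fun ω => F ω i j) =O[l] fun _ => (1 : ℝ) := by
  simpa only [pow_zero] using h i j

theorem matO_zero : MatO l u p fun _ => (0 : Matrix (Fin n) (Fin n) ℝ) :=
  fun _ _ => isBigO_zero _ _

theorem MatO.add (hF : MatO l u p F) (hG : MatO l u p G) : MatO l u p fun ω => F ω + G ω :=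
  fun i j => (hF i j).add (hG i j)

theorem MatO.neg (hF : MatO l u p F) : MatO l u p fun ω => -F ω :=
  fun i j => (hF i j).neg_left

theorem MatO.absM (hF : MatO l u p F) : MatO l u p fun ω => absM (F ω) :=
  fun i j => (hF i j).abs_left

theorem MatO.mul (hF : MatO l u p F) (hG : MatO l u q G) :
    MatO l u (p + q) fun ω => F ω * G ω := by
  intro i j
  simp only [Matrix.mul_apply, pow_add]
  exact IsBigO.fun_sum fun k _ => (hF i k).mul (hG k j)

theorem MatO.const_mul (A : Matrix (Fin n) (Fin n) ℝ) (hF : MatO l u p F) :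
    MatO l u p fun ω => A * F ω := by
  simpa using (matO_const A).mul hF

theorem MatO.mul_const (hF : MatO l u p F) (A : Matrix (Fin n) (Fin n) ℝ) :
    MatO l u p fun ω => F ω * A := by
  simpa using hF.mul (matO_const A)

theorem MatO.smul {e : Ω → ℝ} (he : e =O[l] u) (hF : MatO l u p F) :
    MatO l u (p + 1) fun ω => e ω • F ω := by
  intro i j
  simp only [pow_succ', Matrix.smul_apply, smul_eq_mul]
  exact he.mul (hF i j)

theorem MatO.mono (hu : Tendsto u l (𝓝 0)) (hqp : q ≤ p) (hF : MatO l u p F) : MatO l u q F := by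
  intro i j
  refine (hF i j).trans ?_
  obtain ⟨r, rfl⟩ := Nat.exists_eq_add_of_le hqp
  simp only [pow_add]
  simpa using (isBigO_refl (fun ω => u ω ^ q) l).mul ((hu.pow r).isBigO_one ℝ)

theorem MatO.congr (hF : MatO l u p F) (h : ∀ ω, F ω = G ω) : MatO l u p G := by
  rwa [← funext h]

/-- Turns a residual bound whose right side has known order into the order of the residual itself.
-/
theorem MatO.of_absM_le (hG : MatO l u p G) (h : ∀ᶠ ω in l, ∀ i j, FrobeniusInversion.absM (F ω) i j ≤ G ω i j) :
    MatO l u p F := by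
  intro i j
  refine IsBigO.trans (IsBigO.of_bound 1 ?_) (hG i j)
  filter_upwards [h] with ω hω
  rw [one_mul]
  exact (hω i j).trans (le_abs_self _)

theorem MatLE.of_eventually_le (h : ∀ᶠ ω in l, ∀ i j, F ω i j ≤ G ω i j) : MatLE l u p F G :=
  ⟨_, matO_zero, by simpa using h⟩

theorem MatLE.of_le (h : ∀ ω i j, F ω i j ≤ G ω i j) : MatLE l u p F G :=
  .of_eventually_le (.of_forall h)

theorem MatLE.of_eq (h : ∀ ω, F ω = G ω) : MatLE l u p F G :=
  .of_le fun ω i j => by rw [h]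

theorem MatLE.rfl : MatLE l u p F F := .of_eq fun _ => Eq.refl _

theorem MatLE.trans (h₁ : MatLE l u p F G) (h₂ : MatLE l u p G H) : MatLE l u p F H := by
  obtain ⟨R, hR, h⟩ := h₁
  obtain ⟨R', hR', h'⟩ := h₂
  refine ⟨_, hR.add hR', ?_⟩
  filter_upwards [h, h'] with ω hω hω' i j
  rw [Matrix.add_apply]
  linarith [hω i j, hω' i j]

theorem MatLE.add (h₁ : MatLE l u p F G) (h₂ : MatLE l u p F' G') :
    MatLE l u p (fun ω => F ω + F' ω) fun ω => G ω + G' ω := by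
  obtain ⟨R, hR, h⟩ := h₁
  obtain ⟨R', hR', h'⟩ := h₂
  refine ⟨_, hR.add hR', ?_⟩
  filter_upwards [h, h'] with ω hω hω' i j
  simp only [Matrix.add_apply]
  linarith [hω i j, hω' i j]

theorem MatLE.mul_right (h : MatLE l u p F G) (hM : MatO l u q M) (hM₀ : ∀ ω i j, 0 ≤ M ω i j) :
    MatLE l u (p + q) (fun ω => F ω * M ω) fun ω => G ω * M ω := by
  obtain ⟨R, hR, h⟩ := h
  refine ⟨_, hR.mul hM, ?_⟩
  filter_upwards [h] with ω hω i j
  rw [← Matrix.add_apply, ← add_mul, Matrix.mul_apply, Matrix.mul_apply]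
  exact Finset.sum_le_sum fun k _ => mul_le_mul_of_nonneg_right (hω i k) (hM₀ ω k j)

theorem MatLE.mul_left (h : MatLE l u p F G) (hM : MatO l u q M) (hM₀ : ∀ ω i j, 0 ≤ M ω i j) :
    MatLE l u (q + p) (fun ω => M ω * F ω) fun ω => M ω * G ω := by
  obtain ⟨R, hR, h⟩ := h
  refine ⟨_, hM.mul hR, ?_⟩
  filter_upwards [h] with ω hω i j
  rw [← Matrix.add_apply, ← mul_add, Matrix.mul_apply, Matrix.mul_apply]
  exact Finset.sum_le_sum fun k _ => mul_le_mul_of_nonneg_left (hω k j) (hM₀ ω i k)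

theorem MatLE.mul_absM (h : MatLE l u p F G) (hM : MatO l u 0 M) :
    MatLE l u p (fun ω => F ω * absM (M ω)) fun ω => G ω * absM (M ω) :=
  h.mul_right hM.absM fun _ => absM_nonneg _

theorem MatLE.absM_mul (h : MatLE l u p F G) (hM : MatO l u 0 M) :
    MatLE l u p (fun ω => absM (M ω) * F ω) fun ω => absM (M ω) * G ω := by
  simpa using h.mul_left hM.absM fun _ => absM_nonneg _

theorem MatLE.smul {e : Ω → ℝ} (he : e =O[l] u) (he₀ : ∀ ω, 0 ≤ e ω) (h : MatLE l u p F G) :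
    MatLE l u (p + 1) (fun ω => e ω • F ω) fun ω => e ω • G ω := by
  obtain ⟨R, hR, h⟩ := h
  refine ⟨_, hR.smul he, ?_⟩
  filter_upwards [h] with ω hω i j
  simp only [Matrix.smul_apply, smul_eq_mul, ← mul_add]
  exact mul_le_mul_of_nonneg_left (hω i j) (he₀ ω)

/-- Used to exchange computed and exact matrices inside a bound: an `O(u)` exchange costs only
`O(u²)` once multiplied by a factor of size `u`. -/
theorem MatLE.absM_of_sub (h : MatO l u p fun ω => F ω - G ω) :
    MatLE l u p (fun ω => absM (F ω)) fun ω => absM (G ω) := by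
  refine ⟨_, h.absM, .of_forall fun ω i j => ?_⟩
  have := absM_add_le (G ω) (F ω - G ω) i j
  rwa [add_sub_cancel] at this

theorem MatLE.absM_add (h₁ : MatLE l u p (fun ω => absM (F ω)) G)
    (h₂ : MatLE l u p (fun ω => absM (F' ω)) G') :
    MatLE l u p (fun ω => absM (F ω + F' ω)) fun ω => G ω + G' ω :=
  (MatLE.of_le fun ω => absM_add_le (F ω) (F' ω)).trans (h₁.add h₂)

theorem MatLE.absM_mul_right (h : MatLE l u p (fun ω => absM (F ω)) G) (hM : MatO l u 0 M) :
    MatLE l u p (fun ω => absM (F ω * M ω)) fun ω => G ω * absM (M ω) :=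
  (MatLE.of_le fun ω => absM_mul_le (F ω) (M ω)).trans (h.mul_absM hM)

theorem MatLE.absM_mul_left (h : MatLE l u p (fun ω => absM (F ω)) G) (hM : MatO l u 0 M) :
    MatLE l u p (fun ω => absM (M ω * F ω)) fun ω => absM (M ω) * G ω :=
  (MatLE.of_le fun ω => absM_mul_le (M ω) (F ω)).trans (h.absM_mul hM)

theorem MatLE.congr_left (h : MatLE l u p F G) (hF : ∀ ω, F ω = F' ω) : MatLE l u p F' G := by
  rwa [← funext hF]

theorem MatLE.congr_right (h : MatLE l u p F G) (hG : ∀ ω, G ω = G' ω) : MatLE l u p F G' := by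
  rwa [← funext hG]

/-! ### Inversion via LU decomposition -/

theorem roundErr_isBigO (n : ℕ) : (fun ω => 18 * (n * u ω)) =O[l] u :=
  ((isBigO_refl u l).const_mul_left _).const_mul_left _

theorem FlInverse.error (hu0 : ∀ ω, 0 ≤ u ω) (hu : Tendsto u l (𝓝 0))
    {S : Matrix (Fin n) (Fin n) ℝ} {A L U V : Ω → Matrix (Fin n) (Fin n) ℝ}
    (hS : IsUnit S) (hLU : HasLU S) (hA : MatO l u 1 fun ω => A ω - S)
    (h : ∀ ω, FlInverse (u ω) (A ω) (L ω) (U ω) (V ω)) :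
    MatO l u 0 L ∧ MatO l u 0 U ∧ (MatO l u 1 fun ω => L ω * U ω - A ω) ∧
      (MatO l u 1 fun ω => V ω - S⁻¹) ∧
      MatLE l u 2 (fun ω => absM (V ω - S⁻¹)) fun ω =>
        absM S⁻¹ * ((3 * (18 * (n * u ω))) • (absM (L ω) * absM (U ω)) + absM (A ω - S)) *
          absM S⁻¹ := by
  have hsmall := eventually_four_mul_le_one n hu
  have he0 : ∀ ω, 0 ≤ 18 * (n * u ω) := fun ω => by have := hu0 ω; positivity
  have he : (fun ω => 18 * (n * u ω)) =O[l] u := roundErr_isBigO n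
  choose hF T hT hV using h
  obtain ⟨L₀, U₀, hL₀, hU₀, rfl⟩ := hLU
  have hAt : ∀ i j, Tendsto (fun ω => A ω i j) l (𝓝 ((L₀ * U₀) i j)) := fun i j => by
    have h1 := ((hA i j).trans_tendsto (by simpa using hu)).add_const ((L₀ * U₀) i j)
    simpa using h1
  have hcon := tendsto_of_flLU hu0 hu hL₀ hU₀ hS hAt hF
  have hLO : MatO l u 0 L := matO_of_isBigO_one fun i j => (hcon i j).1.isBigO_one ℝ
  have hUO : MatO l u 0 U := matO_of_isBigO_one fun i j => (hcon i j).2.isBigO_one ℝ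
  have hTO : MatO l u 0 T := matO_of_isBigO_one
    (isBigO_one_of_flUpperInv hu0 hu (hU₀.diag_ne_zero hS) (fun i j => (hcon i j).2) hT)
  have hVO : MatO l u 0 V := matO_of_isBigO_one
    (isBigO_one_of_flSolveLower hu0 hu hLO.isBigO_one hTO.isBigO_one hV)
  set S := L₀ * U₀
  have hLUO : MatO l u 0 fun ω => absM (L ω) * absM (U ω) := hLO.absM.mul hUO.absM
  have b1 : ∀ᶠ ω in l, ∀ i j, absM (L ω * U ω - A ω) i j ≤
      ((18 * (n * u ω)) • (absM (L ω) * absM (U ω))) i j := by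
    filter_upwards [hsmall] with ω hω i j
    exact (hF ω).abs_sub_le (hu0 ω) hω i j
  have b2 : ∀ᶠ ω in l, ∀ i j, absM (T ω * U ω - 1) i j ≤
      ((18 * (n * u ω)) • (absM (T ω) * absM (U ω))) i j := by
    filter_upwards [hsmall] with ω hω i j
    exact (hT ω).abs_sub_le (hu0 ω) hω (hF ω).upper i j
  have b3 : ∀ᶠ ω in l, ∀ i j, absM (V ω * L ω - T ω) i j ≤
      ((18 * (n * u ω)) • (absM (V ω) * absM (L ω))) i j := by
    filter_upwards [hsmall] with ω hω i j
    exact (hV ω).abs_sub_le (hu0 ω) hω (hF ω).lower i j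
  have o1 : MatO l u 1 fun ω => L ω * U ω - A ω := (hLUO.smul he).of_absM_le b1
  have o2 : MatO l u 1 fun ω => T ω * U ω - 1 := ((hTO.absM.mul hUO.absM).smul he).of_absM_le b2
  have o3 : MatO l u 1 fun ω => V ω * L ω - T ω := ((hVO.absM.mul hLO.absM).smul he).of_absM_le b3
  have hdet : IsUnit S.det := (Matrix.isUnit_iff_isUnit_det S).1 hS
  -- The sum of the four residual terms telescopes to `V S - 1`.
  have hD : ∀ ω, ((T ω * U ω - 1) + (V ω * L ω - T ω) * U ω + V ω * -(L ω * U ω - A ω) +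
      V ω * -(A ω - S)) * S⁻¹ = V ω - S⁻¹ := fun ω => by
    have h1 : (T ω * U ω - 1) + (V ω * L ω - T ω) * U ω + V ω * -(L ω * U ω - A ω) +
      V ω * -(A ω - S) = V ω * S - 1 := by noncomm_ring
    rw [h1, sub_mul, one_mul, mul_assoc, Matrix.mul_nonsing_inv _ hdet, mul_one]
  have oV : MatO l u 1 fun ω => V ω - S⁻¹ :=
    ((((o2.add (o3.mul hUO)).add (by simpa using hVO.mul o1.neg)).add
      (by simpa using hVO.mul hA.neg)).mul_const _).congr hD
  refine ⟨hLO, hUO, o1, oV, ?_⟩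
  have oG : MatO l u 1 fun ω =>
      (3 * (18 * (n * u ω))) • (absM (L ω) * absM (U ω)) + absM (A ω - S) :=
    (hLUO.smul (he.const_mul_left 3)).add hA.absM
  have g0 : ∀ ω i j, 0 ≤
      ((3 * (18 * (n * u ω))) • (absM (L ω) * absM (U ω)) + absM (A ω - S)) i j := by
    intro ω i j
    rw [Matrix.add_apply, Matrix.smul_apply, Matrix.mul_apply]
    exact add_nonneg (smul_nonneg (mul_nonneg zero_le_three (he0 ω))
      (Finset.sum_nonneg fun _ _ => mul_nonneg (abs_nonneg _) (abs_nonneg _))) (abs_nonneg _)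
  -- Eliminates `T`: its residual then has the same form `|V||L||U|` as the other two, whence the
  -- factor 3.
  have hTle : MatLE l u 1 (fun ω => absM (T ω)) fun ω => absM (V ω) * absM (L ω) :=
    (MatLE.absM_of_sub (G := fun ω => V ω * L ω) (o3.neg.congr fun ω => by simp)).trans
      (.of_le fun ω => absM_mul_le _ _)
  have m2 : MatLE l u 2 (fun ω => absM (T ω * U ω - 1)) fun ω =>
      (18 * (n * u ω)) • (absM (V ω) * absM (L ω) * absM (U ω)) :=
    (MatLE.of_eventually_le b2).trans ((hTle.mul_absM hUO).smul he he0)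
  have m3 := (MatLE.of_eventually_le (u := u) (p := 2) b3).absM_mul_right hUO
  have m1 := ((MatLE.of_eventually_le (u := u) (p := 2) b1).congr_left
    fun ω => (absM_neg _).symm).absM_mul_left hVO
  have m4 : MatLE l u 2 (fun ω => absM (V ω * -(A ω - S))) fun ω =>
      absM (V ω) * absM (A ω - S) := .of_le fun ω i j => by
    simpa only [absM_neg] using absM_mul_le (V ω) (-(A ω - S)) i j
  have m5 := (((m2.absM_add m3).absM_add m1).absM_add m4).congr_right
    (G' := fun ω => absM (V ω) *
      ((3 * (18 * (n * u ω))) • (absM (L ω) * absM (U ω)) + absM (A ω - S))) fun ω => by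
    simp only [Matrix.smul_mul, Matrix.mul_smul, mul_add, ← mul_assoc]
    module
  -- The bracket is itself `O(u)`, so replacing `|V|` by `|S⁻¹|` changes the bound by `O(u²)`.
  have m6 := m5.trans ((MatLE.absM_of_sub oV).mul_right oG g0)
  exact (m6.absM_mul_right (matO_const S⁻¹)).congr_left fun ω => by rw [hD]

/-! ### The real matrices of Frobenius inversion -/

theorem frobenius_error (hu0 : ∀ ω, 0 ≤ u ω) (hu : Tendsto u l (𝓝 0))
    {X Y : Matrix (Fin n) (Fin n) ℝ} {LX UX V H₁ H₂ P LP UP J K : Ω → Matrix (Fin n) (Fin n) ℝ}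
    (hX : IsUnit X) (hXLU : HasLU X) (hS : IsUnit (X + Y * X⁻¹ * Y))
    (hSLU : HasLU (X + Y * X⁻¹ * Y))
    (hV : ∀ ω, FlInverse (u ω) X (LX ω) (UX ω) (V ω))
    (hH₁ : ∀ ω, FlMatMul (u ω) (V ω) Y (H₁ ω)) (hH₂ : ∀ ω, FlMatMul (u ω) Y (H₁ ω) (H₂ ω))
    (hP : ∀ ω, FlMatAdd (u ω) X (H₂ ω) (P ω))
    (hJ : ∀ ω, FlInverse (u ω) (P ω) (LP ω) (UP ω) (J ω))
    (hK : ∀ ω, FlMatMul (u ω) (H₁ ω) (J ω) (K ω)) :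
    MatLE l u 2
      (fun ω => absM (J ω - exactJ X Y) + absM (K ω - X⁻¹ * Y * exactJ X Y)) fun ω =>
        (6 * (18 * (n * u ω))) • errorBound X Y (LX ω) (UX ω) (LP ω) (UP ω) := by
  have hsmall := eventually_four_mul_le_one n hu
  have he0 : ∀ ω, 0 ≤ 18 * (n * u ω) := fun ω => by have := hu0 ω; positivity
  have he : (fun ω => 18 * (n * u ω)) =O[l] u := roundErr_isBigO n
  have hXdet : IsUnit X.det := (Matrix.isUnit_iff_isUnit_det X).1 hX
  obtain ⟨hLO, hUO, oE, oV, mV⟩ := FlInverse.error hu0 hu hX hXLU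
    (matO_zero.congr fun ω => (sub_self X).symm) hV
  simp only [sub_self] at mV
  set B : Ω → Matrix (Fin n) (Fin n) ℝ :=
    fun ω => absM X⁻¹ * absM (LX ω) * absM (UX ω) * absM X⁻¹ with hB
  have oB : MatO l u 0 B :=
    (((matO_const X⁻¹).absM.mul hLO.absM).mul hUO.absM).mul (matO_const X⁻¹).absM
  have mV' : MatLE l u 2 (fun ω => absM (V ω - X⁻¹)) fun ω => (3 * (18 * (n * u ω))) • B ω :=
    mV.congr_right fun ω => by
      have : absM (0 : Matrix (Fin n) (Fin n) ℝ) = 0 := by ext i j; simp [absM]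
      simp only [this, add_zero, Matrix.mul_smul, Matrix.smul_mul, ← mul_assoc, hB]
  -- Insert `X = L_X U_X + O(u)` in the middle of `X⁻¹ X X⁻¹`. This lets `B` dominate the rounding
  -- errors of the subsequent products.
  have mX : MatLE l u 1 (fun _ => absM X⁻¹) B := by
    have h1 : MatLE l u 1 (fun _ => absM X⁻¹) fun ω => absM (X⁻¹ * LX ω * UX ω * X⁻¹) := by
      refine MatLE.absM_of_sub (((oE.const_mul X⁻¹).mul_const X⁻¹).neg.congr fun ω => ?_)
      rw [mul_sub, sub_mul, Matrix.nonsing_inv_mul _ hXdet, one_mul, neg_sub, ← mul_assoc]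
    refine h1.trans ?_
    exact ((MatLE.of_le fun ω => absM_mul_le X⁻¹ (LX ω)).absM_mul_right hUO).absM_mul_right
      (matO_const X⁻¹)
  have mVB : MatLE l u 1 (fun ω => absM (V ω)) B := (MatLE.absM_of_sub oV).trans mX
  have oV0 : MatO l u 0 V := ((oV.mono hu zero_le_one).add (matO_const X⁻¹)).congr (by simp)
  -- the product `X⁻¹ Y`
  have b1 : ∀ᶠ ω in l, ∀ i j, absM (H₁ ω - V ω * Y) i j ≤
      ((18 * (n * u ω)) • (absM (V ω) * absM Y)) i j := by
    filter_upwards [hsmall] with ω hω i j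
    exact (hH₁ ω).abs_sub_le (hu0 ω) hω i j
  have hD1 : ∀ ω, (V ω - X⁻¹) * Y + (H₁ ω - V ω * Y) = H₁ ω - X⁻¹ * Y := fun ω => by
    rw [sub_mul]; abel
  have oH1 : MatO l u 1 fun ω => H₁ ω - X⁻¹ * Y :=
    ((oV.mul_const Y).add
      (((oV0.absM.mul (matO_const Y).absM).smul he).of_absM_le b1)).congr hD1
  -- Constant `4 = 3 + 1`: the propagated inversion error plus the rounding of this product. The
  -- next product raises it to 5 in the same way.
  have mH1 : MatLE l u 2 (fun ω => absM (H₁ ω - X⁻¹ * Y)) fun ω =>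
      (4 * (18 * (n * u ω))) • (B ω * absM Y) :=
    (((mV'.absM_mul_right (matO_const Y)).absM_add ((MatLE.of_eventually_le b1).trans
      ((mVB.mul_absM (matO_const Y)).smul he he0))).congr_left fun ω => congrArg absM (hD1 ω)).congr_right fun ω => by
        rw [Matrix.smul_mul]; module
  have mH1' : MatLE l u 1 (fun ω => absM (H₁ ω)) fun ω => B ω * absM Y :=
    (MatLE.absM_of_sub oH1).trans (MatLE.absM_mul_right mX (matO_const Y))
  have oH10 : MatO l u 0 H₁ :=
    ((oH1.mono hu zero_le_one).add (matO_const (X⁻¹ * Y))).congr (by simp)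
  -- the product `Y X⁻¹ Y`
  have b2 : ∀ᶠ ω in l, ∀ i j, absM (H₂ ω - Y * H₁ ω) i j ≤
      ((18 * (n * u ω)) • (absM Y * absM (H₁ ω))) i j := by
    filter_upwards [hsmall] with ω hω i j
    exact (hH₂ ω).abs_sub_le (hu0 ω) hω i j
  have hD2 : ∀ ω, Y * (H₁ ω - X⁻¹ * Y) + (H₂ ω - Y * H₁ ω) = H₂ ω - Y * (X⁻¹ * Y) := fun ω => by
    rw [mul_sub]; abel
  have oH2 : MatO l u 1 fun ω => H₂ ω - Y * (X⁻¹ * Y) :=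
    ((oH1.const_mul Y).add
      ((((matO_const Y).absM.mul oH10.absM).smul he).of_absM_le b2)).congr hD2
  have mH2 : MatLE l u 2 (fun ω => absM (H₂ ω - Y * (X⁻¹ * Y))) fun ω =>
      (5 * (18 * (n * u ω))) • (absM Y * (B ω * absM Y)) :=
    (((mH1.absM_mul_left (matO_const Y)).absM_add ((MatLE.of_eventually_le b2).trans
      ((mH1'.absM_mul (matO_const Y)).smul he he0))).congr_left fun ω => congrArg absM (hD2 ω)).congr_right fun ω => by
        rw [Matrix.mul_smul]; module
  have mH2' : MatLE l u 1 (fun ω => absM (H₂ ω)) fun ω => absM Y * (B ω * absM Y) :=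
    (MatLE.absM_of_sub oH2).trans
      (MatLE.absM_mul_left (MatLE.absM_mul_right mX (matO_const Y)) (matO_const Y))
  have oH20 : MatO l u 0 H₂ :=
    ((oH2.mono hu zero_le_one).add (matO_const (Y * (X⁻¹ * Y)))).congr (by simp)
  -- the sum `X + Y X⁻¹ Y`
  have b3 : ∀ᶠ ω in l, ∀ i j, absM (P ω - (X + H₂ ω)) i j ≤
      ((18 * (n * u ω)) • (absM X + absM (H₂ ω))) i j :=
    .of_forall fun ω i j => (hP ω).abs_sub_le (hu0 ω) i j
  have hD3 : ∀ ω, (H₂ ω - Y * (X⁻¹ * Y)) + (P ω - (X + H₂ ω)) = P ω - (X + Y * X⁻¹ * Y) :=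
    fun ω => by rw [mul_assoc]; abel
  have oP : MatO l u 1 fun ω => P ω - (X + Y * X⁻¹ * Y) :=
    (oH2.add ((((matO_const X).absM.add oH20.absM).smul he).of_absM_le b3)).congr hD3
  -- Rounding the sum adds one unit of `|X|` and one of the bound for `|H₂|`, which raises the
  -- constant 5 to 6.
  have mP : MatLE l u 2 (fun ω => absM (P ω - (X + Y * X⁻¹ * Y))) fun ω =>
      (18 * (n * u ω)) • absM X + (6 * (18 * (n * u ω))) • (absM Y * (B ω * absM Y)) :=
    ((mH2.absM_add ((MatLE.of_eventually_le b3).trans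
      ((MatLE.rfl.add mH2').smul he he0))).congr_left
        fun ω => congrArg absM (hD3 ω)).congr_right fun ω => by module
  -- the matrix `J`
  obtain ⟨hLO', hUO', -, oJ, mJ⟩ := FlInverse.error hu0 hu hS hSLU oP hJ
  change MatO l u 1 fun ω => J ω - exactJ X Y at oJ
  change MatLE l u 2 (fun ω => absM (J ω - exactJ X Y)) fun ω =>
    absM (exactJ X Y) * _ * absM (exactJ X Y) at mJ
  set J₀ := exactJ X Y with hJ₀
  set Q : Ω → Matrix (Fin n) (Fin n) ℝ :=
    fun ω => absM X + absM Y * (B ω * absM Y) + absM (LP ω) * absM (UP ω) with hQ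
  -- The coefficients 1, 6 and 3 of the three terms of `Q` are all raised to 6.
  have mJ' : MatLE l u 2 (fun ω => absM (J ω - J₀)) fun ω =>
      (6 * (18 * (n * u ω))) • (absM J₀ * Q ω * absM J₀) := by
    have h1 : MatLE l u 2 (fun ω => (3 * (18 * (n * u ω))) • (absM (LP ω) * absM (UP ω)) +
        absM (P ω - (X + Y * X⁻¹ * Y))) fun ω => (6 * (18 * (n * u ω))) • Q ω := by
      refine (MatLE.rfl.add mP).trans (.of_le fun ω i j => ?_)
      have h2 : 0 ≤ (absM (LP ω) * absM (UP ω)) i j := by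
        rw [Matrix.mul_apply]
        exact Finset.sum_nonneg fun _ _ => mul_nonneg (abs_nonneg _) (abs_nonneg _)
      have h3 := mul_nonneg (he0 ω) h2
      have h4 := mul_nonneg (he0 ω) (absM_nonneg X i j)
      simp only [hQ, Matrix.add_apply, Matrix.smul_apply, smul_eq_mul]
      linarith
    refine (mJ.trans ((h1.absM_mul (matO_const J₀)).mul_absM (matO_const J₀))).congr_right
      fun ω => ?_
    rw [Matrix.mul_smul, Matrix.smul_mul]
  have oJ0 : MatO l u 0 J := ((oJ.mono hu zero_le_one).add (matO_const J₀)).congr (by simp)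
  -- the matrix `K`
  have b4 : ∀ᶠ ω in l, ∀ i j, absM (K ω - H₁ ω * J ω) i j ≤
      ((18 * (n * u ω)) • (absM (H₁ ω) * absM (J ω))) i j := by
    filter_upwards [hsmall] with ω hω i j
    exact (hK ω).abs_sub_le (hu0 ω) hω i j
  have hD4 : ∀ ω, (H₁ ω - X⁻¹ * Y) * J ω + X⁻¹ * Y * (J ω - J₀) + (K ω - H₁ ω * J ω)
      = K ω - X⁻¹ * Y * J₀ := fun ω => by
    rw [sub_mul, mul_sub]; abel
  have oBY : MatO l u 0 fun ω => B ω * absM Y := oB.mul (matO_const Y).absM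
  have bY0 : ∀ ω i j, 0 ≤ (B ω * absM Y) i j := by
    have hmul : ∀ {A C : Matrix (Fin n) (Fin n) ℝ}, (∀ i j, 0 ≤ A i j) → (∀ i j, 0 ≤ C i j) →
        ∀ i j, 0 ≤ (A * C) i j := fun hA hC i j => by
      rw [Matrix.mul_apply]
      exact Finset.sum_nonneg fun _ _ => mul_nonneg (hA _ _) (hC _ _)
    exact fun ω => hmul (hmul (hmul (hmul (absM_nonneg _) (absM_nonneg _)) (absM_nonneg _))
      (absM_nonneg _)) (absM_nonneg _)
  have mBJ : MatLE l u 1 (fun ω => B ω * absM Y * absM (J ω)) fun ω => B ω * absM Y * absM J₀ := by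
    simpa using (MatLE.absM_of_sub oJ).mul_left oBY bY0
  -- The coefficient 5 is 4 from the error of `H₁` plus 1 from rounding the product; the error of
  -- `J` passes through `|X⁻¹Y|` with its coefficient 6.
  have mK : MatLE l u 2 (fun ω => absM (K ω - X⁻¹ * Y * J₀)) fun ω =>
      (5 * (18 * (n * u ω))) • (B ω * absM Y * absM J₀) +
        (6 * (18 * (n * u ω))) • (absM (X⁻¹ * Y) * (absM J₀ * Q ω * absM J₀)) := by
    have h1 := (mH1.absM_mul_right oJ0).trans
      ((mBJ.smul (he.const_mul_left 4) fun ω => mul_nonneg zero_le_four (he0 ω)).congr_left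
        fun ω => (Matrix.smul_mul _ _ _).symm)
    have h2 := mJ'.absM_mul_left (matO_const (X⁻¹ * Y))
    have h3 := (MatLE.of_eventually_le b4).trans
      (((mH1'.mul_absM oJ0).trans mBJ).smul he he0)
    exact (((h1.absM_add h2).absM_add h3).congr_left fun ω => congrArg absM (hD4 ω)).congr_right fun ω => by
      rw [Matrix.mul_smul]; module
  refine (mJ'.add mK).trans (.of_le fun ω i j => ?_)
  have h1 : errorBound X Y (LX ω) (UX ω) (LP ω) (UP ω) = B ω * absM Y * absM J₀ +
      (absM (X⁻¹ * Y) * (absM J₀ * Q ω * absM J₀) + absM J₀ * Q ω * absM J₀) := by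
    simp only [errorBound, hB, hQ, hJ₀, add_mul, mul_add, one_mul, mul_assoc]
    abel
  have h2 : 0 ≤ (B ω * absM Y * absM J₀) i j := by
    rw [Matrix.mul_apply]
    exact Finset.sum_nonneg fun _ _ => mul_nonneg (bY0 ω _ _) (abs_nonneg _)
  have h3 := mul_nonneg (he0 ω) h2
  rw [h1]
  simp only [Matrix.add_apply, Matrix.smul_apply, smul_eq_mul]
  linarith

end

/-! ### The complex inverse -/

theorem complexOf_rePart_imPart {n : ℕ} (Z : Matrix (Fin n) (Fin n) ℂ) :
    complexOf (rePart Z) (imPart Z) = Z := by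
  ext i j
  simp [complexOf, rePart, imPart, mul_comm Complex.I]

theorem complexOf_mul {n : ℕ} (A B C D : Matrix (Fin n) (Fin n) ℝ) :
    complexOf A B * complexOf C D = complexOf (A * C - B * D) (A * D + B * C) := by
  ext i j
  apply Complex.ext <;>
    simp [complexOf, Matrix.mul_apply, Finset.sum_add_distrib, Finset.sum_sub_distrib]

theorem complexOf_one_zero {n : ℕ} : complexOf (1 : Matrix (Fin n) (Fin n) ℝ) 0 = 1 := by
  ext i j
  by_cases h : i = j <;> simp [complexOf, Matrix.one_apply, h]

theorem norm_complexOf_sub_le {n : ℕ} (A B C D : Matrix (Fin n) (Fin n) ℝ) (i j : Fin n) :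
    ‖(complexOf A B - complexOf C D) i j‖ ≤ absM (C - A) i j + absM (D - B) i j := by
  refine (Complex.norm_le_abs_re_add_abs_im _).trans (le_of_eq ?_)
  simp [complexOf, absM, abs_sub_comm]

/-- With `K = X⁻¹ Y J` one has `X J + Y K = 1` and `X K = Y J`. In both branches these are the real
and imaginary parts of `Z` times the output being 1. -/
theorem Branch.inv_eq_output (b : Branch) {n : ℕ} {Z : Matrix (Fin n) (Fin n) ℂ}
    (hX : IsUnit (b.X Z)) (hS : IsUnit (b.X Z + b.Y Z * (b.X Z)⁻¹ * b.Y Z)) :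
    Z⁻¹ = b.output (exactJ (b.X Z) (b.Y Z)) ((b.X Z)⁻¹ * b.Y Z * exactJ (b.X Z) (b.Y Z)) := by
  apply Matrix.inv_eq_right_inv
  rw [Matrix.isUnit_iff_isUnit_det] at hX hS
  set X := b.X Z with hXd
  set Y := b.Y Z with hYd
  have h1 : X * exactJ X Y + Y * (X⁻¹ * Y * exactJ X Y) = 1 := by
    rw [← Matrix.mul_nonsing_inv _ hS, exactJ, add_mul]
    simp only [mul_assoc]
  have h2 : X * (X⁻¹ * Y * exactJ X Y) = Y * exactJ X Y := by
    rw [mul_assoc, Matrix.mul_nonsing_inv_cancel_left _ _ hX]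
  conv_lhs => rw [← complexOf_rePart_imPart Z]
  rw [← complexOf_one_zero]
  cases b
  · change complexOf X Y * complexOf _ _ = _
    rw [complexOf_mul, mul_neg, mul_neg, sub_neg_eq_add, h1, h2, neg_add_cancel]
  · change complexOf Y X * complexOf _ _ = _
    rw [complexOf_mul, mul_neg, mul_neg, sub_neg_eq_add, h2, add_comm, h1, neg_add_cancel]

theorem Branch.norm_output_sub_le (b : Branch) {n : ℕ} (J K J' K' : Matrix (Fin n) (Fin n) ℝ)
    (i j : Fin n) :
    ‖(b.output J K - b.output J' K') i j‖ ≤ (absM (J' - J) + absM (K' - K)) i j := by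
  cases b
  · refine (norm_complexOf_sub_le _ _ _ _ i j).trans (le_of_eq ?_)
    rw [← neg_sub', absM_neg, Matrix.add_apply]
  · refine (norm_complexOf_sub_le _ _ _ _ i j).trans (le_of_eq ?_)
    rw [← neg_sub', absM_neg, Matrix.add_apply, add_comm]

/-- The runs of Frobenius inversion on `Z` along the branch `b`, with all intermediate results. -/
structure Run {n : ℕ} (b : Branch) (Z : Matrix (Fin n) (Fin n) ℂ) where
  /-- the unit roundoff -/
  u : ℝ
  (LX UX P LP UP V H₁ H₂ J K : Matrix (Fin n) (Fin n) ℝ)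
  u_pos : 0 < u
  inv_X : FlInverse u (b.X Z) LX UX V
  mul_H₁ : FlMatMul u V (b.Y Z) H₁
  mul_H₂ : FlMatMul u (b.Y Z) H₁ H₂
  add_P : FlMatAdd u (b.X Z) H₂ P
  inv_P : FlInverse u P LP UP J
  mul_K : FlMatMul u H₁ J K

/-- The filter is the pullback of the neighbourhoods of 0 under the unit roundoff on the type of all
runs. A property holding eventually along it holds for every run with small enough `u`, which yields
`u₀` and `κ` independent of the run. -/
theorem Run.exists_bound {n : ℕ} (b : Branch) (Z : Matrix (Fin n) (Fin n) ℂ)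
    (hX : IsUnit (b.X Z)) (hS : IsUnit (b.X Z + b.Y Z * (b.X Z)⁻¹ * b.Y Z))
    (hXLU : HasLU (b.X Z)) (hSLU : HasLU (b.X Z + b.Y Z * (b.X Z)⁻¹ * b.Y Z)) :
    ∃ u₀ κ : ℝ, 0 < u₀ ∧ 0 ≤ κ ∧ ∀ r : Run b Z, r.u ≤ u₀ → ∀ i j,
      (absM (r.J - exactJ (b.X Z) (b.Y Z)) +
        absM (r.K - (b.X Z)⁻¹ * b.Y Z * exactJ (b.X Z) (b.Y Z))) i j ≤
      108 * n * errorBound (b.X Z) (b.Y Z) r.LX r.UX r.LP r.UP i j * r.u + κ * r.u ^ 2 := by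
  obtain ⟨R, hR, h⟩ := frobenius_error (l := comap (Run.u (b := b) (Z := Z)) (𝓝 0))
    (fun r => r.u_pos.le) tendsto_comap hX hXLU hS hSLU Run.inv_X Run.mul_H₁ Run.mul_H₂ Run.add_P
    Run.inv_P Run.mul_K
  -- Summing over all entries produces one constant `κ` for every `i` and `j`.
  have hsum : (fun r => ∑ i, ∑ j, |R r i j|) =O[comap (Run.u (b := b) (Z := Z)) (𝓝 0)]
      fun r => r.u ^ 2 :=
    IsBigO.fun_sum fun i _ => IsBigO.fun_sum fun j _ => (hR i j).abs_left
  obtain ⟨κ, hκ, hb⟩ := hsum.exists_nonneg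
  have hev := h.and hb.bound
  obtain ⟨ε, hε, hball⟩ := ((Metric.nhds_basis_closedBall).comap _).eventually_iff.1 hev
  refine ⟨ε, κ, hε, hκ, fun r hr i j => ?_⟩
  have hmem : r ∈ Run.u ⁻¹' Metric.closedBall 0 ε := by
    simpa [abs_of_pos r.u_pos] using hr
  obtain ⟨h1, h2⟩ := hball hmem
  have h3 : |R r i j| ≤ ∑ i, ∑ j, |R r i j| :=
    (Finset.single_le_sum (f := fun j => |R r i j|) (fun _ _ => abs_nonneg _)
      (Finset.mem_univ j)).trans (Finset.single_le_sum (f := fun i => ∑ j, |R r i j|)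
        (fun _ _ => Finset.sum_nonneg fun _ _ => abs_nonneg _) (Finset.mem_univ i))
  rw [Real.norm_eq_abs, Real.norm_eq_abs, abs_of_nonneg (sq_nonneg r.u)] at h2
  have h4 := h1 i j
  beta_reduce at h4
  rw [Matrix.smul_apply, smul_eq_mul] at h4
  linarith [le_abs_self (R r i j), le_abs_self (∑ i, ∑ j, |R r i j|)]

theorem Branch.isUnit_of_mem_domain (b : Branch) {n : ℕ} {Z : Matrix (Fin n) (Fin n) ℂ}
    (hZ : Z ∈ b.domain n) :
    IsUnit (b.X Z) ∧ IsUnit (b.X Z + b.Y Z * (b.X Z)⁻¹ * b.Y Z) := by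
  cases b <;> exact hZ.2

end FrobeniusInversion

theorem mainTheorem8 :
    ∃ C : ℝ, 0 < C ∧
      ∀ (n : ℕ) (b : FrobeniusInversion.Branch) (Z : Matrix (Fin n) (Fin n) ℂ),
        Z ∈ b.domain n →
        FrobeniusInversion.HasLU (b.X Z) →
        FrobeniusInversion.HasLU (b.X Z + b.Y Z * (b.X Z)⁻¹ * b.Y Z) →
        ∃ u₀ κ : ℝ, 0 < u₀ ∧ 0 ≤ κ ∧
          ∀ u : ℝ, 0 < u → u ≤ u₀ →
            ∀ (LX UX P LP UP : Matrix (Fin n) (Fin n) ℝ) (W : Matrix (Fin n) (Fin n) ℂ),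
              FrobeniusInversion.FlFrobenius u b Z LX UX P LP UP W →
              ∀ i j : Fin n,
                ‖(Z⁻¹ - W) i j‖ ≤
                  C * n * FrobeniusInversion.errorBound (b.X Z) (b.Y Z) LX UX LP UP i j * u
                    + κ * u ^ 2 := by
  -- `108 = 6 * 18`.
  refine ⟨108, by norm_num, fun n b Z hZ hX hS => ?_⟩
  obtain ⟨hXu, hSu⟩ := b.isUnit_of_mem_domain hZ
  obtain ⟨u₀, κ, hu₀, hκ, h⟩ := FrobeniusInversion.Run.exists_bound b Z hXu hSu hX hS
  refine ⟨u₀, κ, hu₀, hκ, ?_⟩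
  rintro u hu huu LX UX P LP UP _ ⟨V, H₁, H₂, J, K, h1, h2, h3, h4, h5, h6, rfl⟩ i j
  rw [b.inv_eq_output hXu hSu]
  exact (b.norm_output_sub_le _ _ _ _ i j).trans
    (h ⟨u, LX, UX, P, LP, UP, V, H₁, H₂, J, K, hu, h1, h2, h3, h4, h5, h6⟩ huu i j)
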